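/- Let $p=3$, let $m\ge 1$ be an integer, $q=p^m$, and let $\mathbb F_q$ be the field with $q$ elements. Let $M_5$ be the number of solutions $(x_1,\dots,x_5)\in\mathbb F_q^5$ of the system \[ \sum_{i=1}^5 x_i^2=0,\qquad \sum_{i=1}^5 x_i^{p+1}=0,\qquad \sum_{i=1}^5 x_i^{p^2+1}=0 . \] Then \[ M_5=5\,(p^m-1)\,(8p^m-2p-10)+1 . \] Moreover, for $\alpha,\beta,\gamma\in\mathbb F_q$ put \[ S(\alpha,\beta,\gamma)=\sum_{x\in\mathbb F_q}\zeta_p^{\operatorname{Tr}(\alpha x^2+\beta x^{p+1}+\gamma x^{p^2+1})}, \] where $\zeta_p=e^{2\pi i/p}$ and $\operatorname{Tr}:\mathbb F_q\to\mathbb F_p$ is the trace map. Then \[ \sum_{\alpha,\beta,\gamma\in\mathbb F_q}S(\alpha,\beta,\gamma)^5=M_5\cdot p^{3m}. \] -/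

import Mathlib

/-- The solutions in `F⁵` of the system
`∑ xᵢ ^ 2 = ∑ xᵢ ^ (p + 1) = ∑ xᵢ ^ (p ^ 2 + 1) = 0`. -/
def solutionSet (p : ℕ) (F : Type*) [Field F] : Set (Fin 5 → F) :=
  {x | ∑ i, x i ^ 2 = 0 ∧ ∑ i, x i ^ (p + 1) = 0 ∧ ∑ i, x i ^ (p ^ 2 + 1) = 0}

/-- The number of solutions in `F⁵` of the system. -/
noncomputable def M5 (p : ℕ) (F : Type*) [Field F] : ℕ :=
  (solutionSet p F).ncard

/-- The exponential sum
`S(α, β, γ) = ∑ x, ζ_p ^ Tr(α x ^ 2 + β x ^ (p + 1) + γ x ^ (p ^ 2 + 1))`, where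
`ζ_p = exp(2πi/p)` and `Tr` is the trace from `F` to the prime field `ℤ/pℤ`. -/
noncomputable def expSum (p : ℕ) {F : Type*} [Field F] [Fintype F] [Algebra (ZMod p) F]
    (α β γ : F) : ℂ :=
  ∑ x : F, Complex.exp (2 * Real.pi * Complex.I / p) ^
    (Algebra.trace (ZMod p) F (α * x ^ 2 + β * x ^ (p + 1) + γ * x ^ (p ^ 2 + 1))).val

/-!
Let `F` be an extension of a finite field `K` with `q` elements. If `x ∈ F ^ 5` is orthogonal to
`x`, `x ^ q` and `x ^ q ^ 2`, these three conjugates span a totally isotropic subspace, which has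
dimension at most `2`, so they are linearly dependent over `F`. The coordinates of `x` are thus
zeros of a nonzero `q`-polynomial with three terms, and span a `K`-space of dimension `r ≤ 2`. In a
basis `a` of that space, `x = ∑ aₖ Uₖ` with rows `Uₖ ∈ K ^ 5`; since the Moore matrix of `a` is
invertible, `x` is a solution if and only if the rows `Uₖ` span a totally isotropic subspace of
`K ^ 5`. The bases of such subspaces are counted one row at a time by quadratic Gauss sums, and
double counting the pairs `(x, a)` gives the number of solutions. The fifth moment of `expSum` is
the same count by orthogonality of characters.
-/

open Finset Matrix

section Moore

theorem frobeniusAlgHom_pow_apply (K : Type*) [Field K] [Fintype K] {F : Type*} [Field F]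
    [Algebra K F] (j : ℕ) (a : F) :
    (FiniteField.frobeniusAlgHom K F ^ j) a = a ^ Fintype.card K ^ j := by
  rw [AlgHom.coe_pow, FiniteField.coe_frobeniusAlgHom, pow_iterate]

open Polynomial in
/-- The `q`-polynomial `c₀ X + c₁ X ^ q + c₂ X ^ q ^ 2 + ⋯`, where `q = |K|`; it bounds the number
of zeros of `linearizedMap`. -/
noncomputable def linearizedPolynomial (K : Type*) [Fintype K] {F : Type*} [Field F] {r : ℕ}
    (c : Fin r → F) : F[X] :=
  ∑ j, C (c j) * X ^ Fintype.card K ^ (j : ℕ)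

theorem coeff_linearizedPolynomial (K : Type*) [Field K] [Fintype K] {F : Type*} [Field F] {r : ℕ}
    (c : Fin r → F) (j : Fin r) :
    (linearizedPolynomial K c).coeff (Fintype.card K ^ (j : ℕ)) = c j := by
  have hinj := Nat.pow_right_injective (Fintype.one_lt_card (α := K))
  simp only [linearizedPolynomial, Polynomial.finsetSum_coeff, Polynomial.coeff_C_mul,
    Polynomial.coeff_X_pow, hinj.eq_iff, Fin.val_inj, mul_ite, mul_one, mul_zero,
    sum_ite_eq, mem_univ, if_true]

theorem natDegree_linearizedPolynomial_lt (K : Type*) [Field K] [Fintype K] {F : Type*} [Field F]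
    {r : ℕ} (c : Fin r → F) : (linearizedPolynomial K c).natDegree < Fintype.card K ^ r := by
  rw [← Nat.le_sub_one_iff_lt (by positivity)]
  refine Polynomial.natDegree_sum_le_of_forall_le _ _ fun j _ => ?_
  exact (Polynomial.natDegree_C_mul_X_pow_le _ _).trans
    (Nat.le_sub_one_of_lt (Nat.pow_lt_pow_right Fintype.one_lt_card j.isLt))

variable (K : Type*) [Field K] [Fintype K] {F : Type*} [Field F] [Algebra K F] {r : ℕ}

/-- The `K`-linear map `z ↦ c₀ z + c₁ z ^ q + c₂ z ^ q ^ 2 + ⋯`, where `q = |K|`; it expresses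
linear relations between Frobenius conjugates. -/
def linearizedMap (c : Fin r → F) : F →ₗ[K] F :=
  ∑ j, c j • (FiniteField.frobeniusAlgHom K F ^ (j : ℕ)).toLinearMap

theorem linearizedMap_apply (c : Fin r → F) (z : F) :
    linearizedMap K c z = ∑ j, c j * z ^ Fintype.card K ^ (j : ℕ) := by
  simp only [linearizedMap, LinearMap.sum_apply, LinearMap.smul_apply, AlgHom.toLinearMap_apply,
    frobeniusAlgHom_pow_apply, smul_eq_mul]

theorem eval_linearizedPolynomial (c : Fin r → F) (z : F) :
    (linearizedPolynomial K c).eval z = linearizedMap K c z := by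
  simp only [linearizedPolynomial, linearizedMap_apply, Polynomial.eval_finsetSum,
    Polynomial.eval_mul, Polynomial.eval_C, Polynomial.eval_pow, Polynomial.eval_X]

variable {K}

/-- The kernel would contain `q ^ r` elements, too many for a polynomial of degree below `q ^ r`. -/
theorem eq_zero_of_linearizedMap_eq_zero {a c : Fin r → F} (ha : LinearIndependent K a)
    (hac : ∀ k, linearizedMap K c (a k) = 0) : c = 0 := by
  have hspan (t : Fin r → K) :
      (linearizedPolynomial K c).eval (Fintype.linearCombination K a t) = 0 := by
    simp only [eval_linearizedPolynomial, Fintype.linearCombination_apply, map_sum, map_smul, hac,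
      smul_zero, sum_const_zero]
  have hzero : linearizedPolynomial K c = 0 :=
    Polynomial.eq_zero_of_natDegree_lt_card_of_eval_eq_zero _
      (LinearIndependent.fintypeLinearCombination_injective ha) hspan
      (by simpa using natDegree_linearizedPolynomial_lt K c)
  funext j
  rw [← coeff_linearizedPolynomial K c j, hzero, Polynomial.coeff_zero, Pi.zero_apply]

variable (K) in
/-- The Moore matrix of `a`, with rows `(a k, a k ^ q, a k ^ q ^ 2, …)` where `q = |K|`: the
analogue of the Vandermonde matrix for linear independence over `K`. -/
def mooreMatrix (a : Fin r → F) : Matrix (Fin r) (Fin r) F :=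
  of fun k j => a k ^ Fintype.card K ^ (j : ℕ)

theorem det_mooreMatrix_ne_zero {a : Fin r → F} (ha : LinearIndependent K a) :
    (mooreMatrix K a).det ≠ 0 := by
  intro hdet
  obtain ⟨c, hc, hac⟩ := exists_mulVec_eq_zero_iff.2 hdet
  refine hc (eq_zero_of_linearizedMap_eq_zero ha fun k => ?_)
  rw [linearizedMap_apply]
  exact (sum_congr rfl fun j _ => mul_comm _ _).trans (congrFun hac k)

end Moore

section FrobeniusIsotropic

/-- `x` is orthogonal to its first `s` Frobenius conjugates, `x` itself included: it solves the
system `∑ xᵢ ^ (q ^ j + 1) = 0` for `j < s`, where `q = |K|`. -/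
def IsFrobeniusIsotropic (K : Type*) [Fintype K] {F : Type*} [Field F] {ι : Type*} [Fintype ι]
    (s : ℕ) (x : ι → F) : Prop :=
  ∀ j < s, x ⬝ᵥ (fun i => x i ^ Fintype.card K ^ j) = 0

variable {K : Type*} [Field K] [Fintype K] {F : Type*} [Field F] [Algebra K F] {ι : Type*}
  [Fintype ι] {s : ℕ}

theorem dotProduct_pow_card_pow (j : ℕ) (x y : ι → F) :
    (fun i => x i ^ Fintype.card K ^ j) ⬝ᵥ (fun i => y i ^ Fintype.card K ^ j) =
      (x ⬝ᵥ y) ^ Fintype.card K ^ j := by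
  simp only [dotProduct, ← frobeniusAlgHom_pow_apply, map_sum, map_mul]

theorem IsFrobeniusIsotropic.dotProduct_conjugates {x : ι → F} (hx : IsFrobeniusIsotropic K s x)
    {i j : ℕ} (hi : i < s) (hj : j < s) :
    (fun k => x k ^ Fintype.card K ^ i) ⬝ᵥ (fun k => x k ^ Fintype.card K ^ j) = 0 := by
  wlog hij : i ≤ j generalizing i j
  · rw [dotProduct_comm, this hj hi (le_of_not_ge hij)]
  have hshift := dotProduct_pow_card_pow (K := K) i x fun k => x k ^ Fintype.card K ^ (j - i)
  simp only [← pow_mul, ← pow_add, Nat.sub_add_cancel hij, hx (j - i) (by lia)] at hshift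
  rw [hshift, zero_pow (pow_ne_zero _ Fintype.card_ne_zero)]

/-- The `s` conjugates of `x` span a totally isotropic subspace of `F ^ ι`, whose dimension is at
most half that of the space. -/
theorem IsFrobeniusIsotropic.exists_linearizedMap_eq_zero {x : ι → F}
    (hx : IsFrobeniusIsotropic K s x) (hs : Fintype.card ι < 2 * s) :
    ∃ c : Fin s → F, c ≠ 0 ∧ ∀ i, linearizedMap K c (x i) = 0 := by
  let M : Matrix (Fin s) ι F := of fun j i => x i ^ Fintype.card K ^ (j : ℕ)
  have hMM : M * Mᵀ = 0 := by
    ext i j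
    exact hx.dotProduct_conjugates i.isLt j.isLt
  have hdep : ¬ LinearIndependent F M.row := fun hli => by
    have hrank := rank_add_rank_le_card_of_mul_eq_zero hMM
    rw [rank_transpose, hli.rank_matrix, Fintype.card_fin] at hrank
    lia
  obtain ⟨c, hc, k, hk⟩ := Fintype.not_linearIndependent_iff.1 hdep
  refine ⟨c, fun h => hk (congrFun h k), fun i => ?_⟩
  simpa [M, linearizedMap_apply] using congrFun hc i

theorem IsFrobeniusIsotropic.finrank_span_range_lt {x : ι → F} (hx : IsFrobeniusIsotropic K s x)
    (hs : Fintype.card ι < 2 * s) : Module.finrank K (Submodule.span K (Set.range x)) < s := by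
  obtain ⟨c, hc, hroot⟩ := hx.exists_linearizedMap_eq_zero hs
  have hker : Submodule.span K (Set.range x) ≤ (linearizedMap K c).ker :=
    Submodule.span_le.2 (Set.range_subset_iff.2 hroot)
  by_contra! hle
  obtain ⟨a, ha⟩ := exists_linearIndependent_of_le_finrank hle
  exact hc (eq_zero_of_linearizedMap_eq_zero
    (ha.map' (Submodule.subtype _) (Submodule.ker_subtype _)) fun k => hker (a k).2)

end FrobeniusIsotropic

section RowCombination

variable {K : Type*} [Field K] {F : Type*} [Field F] [Algebra K F] {ι : Type*} {r : ℕ}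

/-- The vector `∑ k, a k • U k` of `F ^ ι`, for coefficients `a` in `F` and rows `U k` in `K ^ ι`.
For independent `a`, it identifies the vectors whose entries lie in the `K`-span of `a` with
matrices. -/
def rowCombination (a : Fin r → F) (U : Matrix (Fin r) ι K) : ι → F :=
  a ᵥ* U.map (algebraMap K F)

theorem rowCombination_apply (a : Fin r → F) (U : Matrix (Fin r) ι K) (i : ι) :
    rowCombination a U i = Fintype.linearCombination K a fun k => U k i := by
  simp only [rowCombination, vecMul, dotProduct, map_apply, Fintype.linearCombination_apply,
    Algebra.smul_def, mul_comm]

theorem rowCombination_injective {a : Fin r → F} (ha : LinearIndependent K a) :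
    Function.Injective (rowCombination (ι := ι) a : Matrix (Fin r) ι K → ι → F) := by
  intro U V hUV
  ext k i
  have hi := congrFun hUV i
  simp only [rowCombination_apply] at hi
  exact congrFun (LinearIndependent.fintypeLinearCombination_injective ha hi) k

theorem exists_rowCombination_eq {a : Fin r → F} {x : ι → F}
    (hx : Set.range x ⊆ Submodule.span K (Set.range a)) :
    ∃ U : Matrix (Fin r) ι K, rowCombination a U = x := by
  rw [← Fintype.range_linearCombination] at hx
  choose u hu using Set.range_subset_iff.1 hx
  exact ⟨of fun k i => u i k, funext fun i => (rowCombination_apply a _ i).trans (hu i)⟩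

theorem rowCombination_pow [Fintype K] (a : Fin r → F) (U : Matrix (Fin r) ι K) (j : ℕ) (i : ι) :
    rowCombination a U i ^ Fintype.card K ^ j =
      rowCombination (fun k => a k ^ Fintype.card K ^ j) U i := by
  simp only [rowCombination_apply, Fintype.linearCombination_apply, ← frobeniusAlgHom_pow_apply,
    map_sum, map_smul]

variable [Fintype ι]

theorem dotProduct_rowCombination (a b : Fin r → F) (U : Matrix (Fin r) ι K) :
    rowCombination a U ⬝ᵥ rowCombination b U = rowCombination a (U * Uᵀ) ⬝ᵥ b := by
  rw [rowCombination, rowCombination, rowCombination, Matrix.map_mul, transpose_map,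
    ← vecMul_vecMul, ← mulVec_transpose _ b, dotProduct_mulVec]

theorem linearCombination_rowCombination (a : Fin r → F) (U : Matrix (Fin r) ι K) :
    Fintype.linearCombination K (rowCombination a U) =
      Fintype.linearCombination K a ∘ₗ U.mulVecLin := by
  refine LinearMap.ext fun y => ?_
  simp only [LinearMap.comp_apply, Fintype.linearCombination_apply, rowCombination_apply,
    mulVecLin_apply, mulVec, dotProduct, smul_sum, sum_smul, smul_smul, mul_comm]
  exact sum_comm

theorem linearIndependent_row_iff_range_mulVecLin_eq_top {U : Matrix (Fin r) ι K} :
    LinearIndependent K U.row ↔ U.mulVecLin.range = ⊤ := by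
  rw [linearIndependent_iff_card_eq_finrank_span, Set.finrank, ← rank_eq_finrank_span_row, rank,
    Fintype.card_fin]
  refine ⟨fun h => Submodule.eq_top_of_finrank_eq ?_, fun h => ?_⟩
  · rw [← h, Module.finrank_fin_fun]
  · rw [h, finrank_top, Module.finrank_fin_fun]

theorem span_range_rowCombination_eq_iff {ι : Type*} [Finite ι] {a : Fin r → F}
    (ha : LinearIndependent K a) {U : Matrix (Fin r) ι K} :
    Submodule.span K (Set.range (rowCombination a U)) = Submodule.span K (Set.range a) ↔
      LinearIndependent K U.row := by
  have := Fintype.ofFinite ι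
  rw [linearIndependent_row_iff_range_mulVecLin_eq_top, ← Fintype.range_linearCombination,
    linearCombination_rowCombination, LinearMap.range_comp, ← Fintype.range_linearCombination,
    LinearMap.range_eq_map (Fintype.linearCombination K a)]
  exact (Submodule.map_injective_of_injective
    (LinearIndependent.fintypeLinearCombination_injective ha)).eq_iff

/-- The pairings of `x = rowCombination a U` with its conjugates are obtained from `a` and the Gram
matrix `U * Uᵀ` by applying the Moore matrix of `a`, which is invertible. -/
theorem isFrobeniusIsotropic_rowCombination_iff [Fintype K] {s : ℕ} (hrs : r ≤ s) {a : Fin r → F}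
    (ha : LinearIndependent K a) {U : Matrix (Fin r) ι K} :
    IsFrobeniusIsotropic K s (rowCombination a U) ↔ U * Uᵀ = 0 := by
  have hpair (j : ℕ) :
      rowCombination a U ⬝ᵥ (fun i => rowCombination a U i ^ Fintype.card K ^ j) =
        rowCombination a (U * Uᵀ) ⬝ᵥ fun k => a k ^ Fintype.card K ^ j := by
    simp only [rowCombination_pow, dotProduct_rowCombination]
  have hzero : rowCombination a (0 : Matrix (Fin r) (Fin r) K) = 0 := by
    simp [rowCombination]
  simp only [IsFrobeniusIsotropic, hpair]
  refine ⟨fun h => rowCombination_injective ha ?_, fun h j _ => ?_⟩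
  · rw [hzero]
    exact eq_zero_of_vecMul_eq_zero (det_mooreMatrix_ne_zero ha)
      (funext fun j => h j (j.isLt.trans_le hrs))
  · rw [h, hzero, zero_dotProduct]

end RowCombination

section CharacterSum

theorem sum_fin_succ_arrow {α M : Type*} [Fintype α] [AddCommMonoid M] {n : ℕ}
    (f : (Fin (n + 1) → α) → M) : ∑ a, f a = ∑ b, ∑ t, f (vecCons b t) := by
  rw [← Fintype.sum_prod_type']
  exact (Fintype.sum_equiv (Fin.consEquiv fun _ => α) _ _ fun _ => rfl).symm

theorem addChar_sum_eq_prod {A M ι : Type*} [AddCommMonoid A] [CommMonoid M] [Fintype ι]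
    {ψ : AddChar A M} (f : ι → A) : ψ (∑ i, f i) = ∏ i, ψ (f i) :=
  map_prod ψ.toMonoidHom (fun i => Multiplicative.ofAdd (f i)) univ

variable {F : Type*} [Field F] [Fintype F] {ι : Type*} [Fintype ι] {R : Type*} [CommRing R]
  {ψ : AddChar F R}

theorem sum_addChar_mul_dotProduct_self [DecidableEq ι] (s : F) :
    ∑ v : ι → F, ψ (s * (v ⬝ᵥ v)) = (∑ x, ψ (s * x ^ 2)) ^ Fintype.card ι := by
  simp only [dotProduct, mul_sum, addChar_sum_eq_prod, ← sq]
  rw [← Fintype.prod_sum fun _ x => ψ (s * x ^ 2), prod_const, card_univ]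

theorem sum_addChar_mul_dotProduct_self_add (hF : ringChar F ≠ 2) [DecidableEq ι] {s : F}
    (hs : s ≠ 0) {u : ι → F} (hu : u ⬝ᵥ u = 0) :
    ∑ v : ι → F, ψ (s * (v ⬝ᵥ v) + u ⬝ᵥ v) = ∑ v : ι → F, ψ (s * (v ⬝ᵥ v)) := by
  have hcenter : 2 * s * (2 * s)⁻¹ = 1 :=
    mul_inv_cancel₀ (mul_ne_zero (Ring.two_ne_zero hF) hs)
  refine Fintype.sum_equiv (Equiv.addRight ((2 * s)⁻¹ • u)) _ _ fun v => congrArg ψ ?_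
  simp only [Equiv.coe_addRight, add_dotProduct, dotProduct_add, smul_dotProduct, dotProduct_smul,
    smul_eq_mul, hu, dotProduct_comm v u]
  linear_combination (-(u ⬝ᵥ v)) * hcenter

variable [IsDomain R]

theorem sum_addChar_dotProduct (hψ : ψ.IsPrimitive) [DecidableEq ι] [DecidableEq F] (y : ι → F) :
    ∑ a : ι → F, ψ (a ⬝ᵥ y) = if y = 0 then (Fintype.card F : R) ^ Fintype.card ι else 0 := by
  simp only [dotProduct, addChar_sum_eq_prod]
  rw [← Fintype.prod_sum fun i x => ψ (x * y i)]
  simp only [AddChar.sum_mulShift _ hψ, Nat.cast_ite, Nat.cast_zero]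
  rw [prod_ite_zero, prod_const, card_univ]
  simp only [mem_univ, forall_true_left, funext_iff, Pi.zero_apply]

theorem sum_sum_addChar_dotProduct (hψ : ψ.IsPrimitive) [DecidableEq ι] [DecidableEq F] {X : Type*}
    [Fintype X] (g : X → ι → F) :
    ∑ a : ι → F, ∑ x, ψ (a ⬝ᵥ g x) = #{x | g x = 0} * (Fintype.card F : R) ^ Fintype.card ι := by
  rw [sum_comm]
  simp only [sum_addChar_dotProduct hψ]
  rw [← sum_filter, sum_const, nsmul_eq_mul]

theorem sum_addChar_mul_sq (hF : ringChar F ≠ 2) (hψ : ψ.IsPrimitive) [DecidableEq F] {s : F}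
    (hs : s ≠ 0) :
    ∑ x, ψ (s * x ^ 2) = quadraticChar F s *
      gaussSum ((quadraticChar F).ringHomComp (Int.castRingHom R)) ψ := by
  have hsqrts (y : F) : (#{x : F | x ^ 2 = y} : R) = quadraticChar F y + 1 := by
    have h := quadraticChar_card_sqrts hF y
    rw [Set.toFinset_ofPred] at h
    exact_mod_cast congrArg (Int.cast : ℤ → R) h
  have hlinear : ∑ y, ψ (s * y) = 0 := by
    simpa [hs, mul_comm] using AddChar.sum_mulShift s hψ
  calc ∑ x, ψ (s * x ^ 2) = ∑ y, (#{x : F | x ^ 2 = y} : R) * ψ (s * y) := by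
        rw [← sum_fiberwise univ (fun x : F => x ^ 2)]
        refine sum_congr rfl fun y _ => ?_
        rw [← nsmul_eq_mul, ← sum_const]
        exact sum_congr rfl fun x hx => by rw [(mem_filter_univ x).1 hx]
    _ = gaussSum ((quadraticChar F).ringHomComp (Int.castRingHom R)) (ψ.mulShift s) := by
        simp only [hsqrts, add_mul, one_mul, sum_add_distrib, hlinear, add_zero]
        rfl
    _ = _ := by
        have h := gaussSum_mulShift_eq ((quadraticChar F).ringHomComp (Int.castRingHom R)) ψ
          (Units.mk0 s hs)
        rw [(quadraticChar_isQuadratic F).comp _ |>.inv] at h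
        exact h

theorem sum_sum_addChar_mul_dotProduct_self (hF : ringChar F ≠ 2) (hψ : ψ.IsPrimitive)
    [DecidableEq F] [DecidableEq ι] (hι : Odd (Fintype.card ι)) :
    ∑ s ∈ {(0 : F)}ᶜ, ∑ v : ι → F, ψ (s * (v ⬝ᵥ v)) = 0 := by
  set g := gaussSum ((quadraticChar F).ringHomComp (Int.castRingHom R)) ψ
  have hterm (s : F) (hs : s ∈ ({0}ᶜ : Finset F)) :
      ∑ v : ι → F, ψ (s * (v ⬝ᵥ v)) = quadraticChar F s * g ^ Fintype.card ι := by
    rw [sum_addChar_mul_dotProduct_self, sum_addChar_mul_sq hF hψ (by simpa using hs), mul_pow,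
      ← Int.cast_pow, ← MulChar.pow_apply' _ hι.pos.ne', (quadraticChar_isQuadratic F).pow_odd hι]
  rw [sum_congr rfl hterm, ← sum_mul, ← Int.cast_sum]
  have h := quadraticChar_sum_zero hF
  rw [Fintype.sum_eq_add_sum_compl 0, quadraticChar_zero, zero_add] at h
  rw [h, Int.cast_zero, zero_mul]

end CharacterSum

section IsotropicFrame

/-- A basis of a totally isotropic subspace of dimension `r` in the quadratic space `K ^ ι` with
form `∑ xᵢ ^ 2`, as the rows of a matrix. -/
def IsIsotropicFrame {K ι : Type*} [Field K] [Fintype ι] {r : ℕ} (U : Matrix (Fin r) ι K) : Prop :=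
  LinearIndependent K U.row ∧ U * Uᵀ = 0

variable {K ι : Type*} [Field K] [Fintype ι] {r : ℕ}

theorem IsIsotropicFrame.vecMul_dotProduct_vecMul {U : Matrix (Fin r) ι K} (hU : IsIsotropicFrame U)
    (t u : Fin r → K) : (t ᵥ* U) ⬝ᵥ (u ᵥ* U) = 0 := by
  rw [← mulVec_transpose U u, dotProduct_mulVec, vecMul_vecMul, hU.2, vecMul_zero, zero_dotProduct]

theorem isIsotropicFrame_vecCons_iff {v : ι → K} {U : Matrix (Fin r) ι K} :
    IsIsotropicFrame (of (vecCons v U)) ↔ IsIsotropicFrame U ∧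
      (v ⬝ᵥ v = 0 ∧ U *ᵥ v = 0) ∧ v ∉ Submodule.span K (Set.range U.row) := by
  have hgram : of (vecCons v U) * (of (vecCons v U))ᵀ = 0 ↔
      U * Uᵀ = 0 ∧ v ⬝ᵥ v = 0 ∧ U *ᵥ v = 0 := by
    refine ⟨fun h => ⟨?_, congrFun₂ h 0 0, funext fun j => congrFun₂ h j.succ 0⟩, fun h => ?_⟩
    · ext j k
      exact congrFun₂ h j.succ k.succ
    · obtain ⟨hUU, hvv, hUv⟩ := h
      ext j k
      refine Fin.cases (Fin.cases hvv fun k => ?_) (fun j => Fin.cases ?_ fun k => ?_) j k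
      · exact (dotProduct_comm _ _).trans (congrFun hUv k)
      · exact congrFun hUv j
      · exact congrFun₂ hUU j k
  have hli : LinearIndependent K (of (vecCons v U)).row ↔
      LinearIndependent K U.row ∧ v ∉ Submodule.span K (Set.range U.row) :=
    linearIndependent_finCons
  rw [IsIsotropicFrame, IsIsotropicFrame, hgram, hli]
  tauto

theorem IsIsotropicFrame.orthogonal_of_mem_span {U : Matrix (Fin r) ι K} (hU : IsIsotropicFrame U)
    {v : ι → K} (hv : v ∈ Submodule.span K (Set.range U.row)) : v ⬝ᵥ v = 0 ∧ U *ᵥ v = 0 := by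
  obtain ⟨t, rfl⟩ := (range_vecMulLinear U ▸ hv : v ∈ U.vecMulLinear.range)
  exact ⟨hU.vecMul_dotProduct_vecMul t t,
    by rw [vecMulLinear_apply, ← mulVec_transpose, mulVec_mulVec, hU.2, zero_mulVec]⟩

variable [Fintype K]

open Classical in
/-- The conditions are detected by characters `ψ (s * (v ⬝ᵥ v) + t ⬝ᵥ (U *ᵥ v))`. For `s ≠ 0`,
completing the square removes `t`; the remaining odd power of the quadratic Gauss sum varies with
`s` as the quadratic character, so these terms cancel and only `s = 0` contributes. -/
theorem IsIsotropicFrame.card_orthogonal (hK : ringChar K ≠ 2) (hι : Odd (Fintype.card ι))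
    {U : Matrix (Fin r) ι K} (hU : IsIsotropicFrame U) :
    #{v : ι → K | v ⬝ᵥ v = 0 ∧ U *ᵥ v = 0} * Fintype.card K ^ (r + 1) =
      Fintype.card K ^ Fintype.card ι := by
  set ψ := AddChar.FiniteField.primitiveChar_to_Complex K
  have hψ : ψ.IsPrimitive := AddChar.FiniteField.primitiveChar_to_Complex_isPrimitive K
  have hcount := sum_sum_addChar_dotProduct hψ fun v : ι → K => vecCons (v ⬝ᵥ v) (U *ᵥ v)
  have hzero : ∑ t : Fin r → K, ∑ v : ι → K, ψ ((t ᵥ* U) ⬝ᵥ v) =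
      (Fintype.card K : ℂ) ^ Fintype.card ι := by
    have hker (t : Fin r → K) : t ᵥ* U = 0 ↔ t = 0 :=
      ⟨fun h => vecMul_injective_iff.2 hU.1 (h.trans (zero_vecMul U).symm),
        fun h => h ▸ zero_vecMul U⟩
    simp only [← dotProduct_comm _ (_ ᵥ* U), sum_addChar_dotProduct hψ, hker]
    rw [Fintype.sum_ite_eq' 0 fun _ => _]
  have hne : ∑ s ∈ ({0}ᶜ : Finset K), ∑ t : Fin r → K, ∑ v : ι → K,
      ψ (s * (v ⬝ᵥ v) + (t ᵥ* U) ⬝ᵥ v) = 0 := by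
    rw [sum_comm]
    refine sum_eq_zero fun t _ => ?_
    rw [← sum_sum_addChar_mul_dotProduct_self hK hψ hι]
    refine sum_congr rfl fun s hs => ?_
    exact sum_addChar_mul_dotProduct_self_add hK (by simpa using hs)
      (hU.vecMul_dotProduct_vecMul t t)
  rw [sum_fin_succ_arrow, Fintype.sum_eq_add_sum_compl 0] at hcount
  simp only [cons_dotProduct_cons, dotProduct_mulVec, hne, zero_mul, zero_add, hzero, add_zero,
    cons_eq_zero_iff, Fintype.card_fin] at hcount
  exact_mod_cast hcount.symm

open Classical in
theorem IsIsotropicFrame.card_extension (hK : ringChar K ≠ 2) (hι : Odd (Fintype.card ι))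
    {U : Matrix (Fin r) ι K} (hU : IsIsotropicFrame U) :
    (#{v : ι → K | (v ⬝ᵥ v = 0 ∧ U *ᵥ v = 0) ∧ v ∉ Submodule.span K (Set.range U.row)} : ℤ) =
      Fintype.card K ^ (Fintype.card ι - 1 - r) - Fintype.card K ^ r := by
  have hspan : #{v : ι → K | v ∈ Submodule.span K (Set.range U.row)} = Fintype.card K ^ r := by
    have hfinrank := (finrank_span_eq_card hU.1).trans (Fintype.card_fin r)
    rw [← Fintype.card_subtype]
    exact Module.card_eq_pow_finrank.trans (congrArg (Fintype.card K ^ ·) hfinrank)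
  have hsub : ({v : ι → K | v ∈ Submodule.span K (Set.range U.row)} : Finset (ι → K)) ⊆
      ({v | v ⬝ᵥ v = 0 ∧ U *ᵥ v = 0} : Finset (ι → K)) :=
    monotone_filter_right _ fun _ _ hv => hU.orthogonal_of_mem_span hv
  have hrank := rank_add_rank_le_card_of_mul_eq_zero hU.2
  rw [rank_transpose, hU.1.rank_matrix, Fintype.card_fin] at hrank
  have hcard : #{v : ι → K | v ⬝ᵥ v = 0 ∧ U *ᵥ v = 0} =
      Fintype.card K ^ (Fintype.card ι - 1 - r) := by
    refine Nat.eq_of_mul_eq_mul_right (pow_pos (Fintype.card_pos (α := K)) (r + 1)) ?_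
    rw [hU.card_orthogonal hK hι, ← pow_add]
    congr 1
    obtain ⟨k, hk⟩ := hι
    lia
  rw [filter_and_not, cast_card_sdiff hsub, hcard, hspan, Nat.cast_pow, Nat.cast_pow]

open Classical in
theorem card_isIsotropicFrame (hK : ringChar K ≠ 2) (hι : Odd (Fintype.card ι)) (r : ℕ) :
    (#{U : Matrix (Fin r) ι K | IsIsotropicFrame U} : ℤ) =
      ∏ i : Fin r, ((Fintype.card K : ℤ) ^ (Fintype.card ι - 1 - i) -
        Fintype.card K ^ (i : ℕ)) := by
  induction r with
  | zero =>
    have hframe : IsIsotropicFrame (0 : Matrix (Fin 0) ι K) :=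
      ⟨linearIndependent_empty_type, Subsingleton.elim _ _⟩
    rw [card_eq_one.2 ⟨0, eq_singleton_iff_unique_mem.2
      ⟨(mem_filter_univ _).2 hframe, fun _ _ => Subsingleton.elim _ _⟩⟩]
    rfl
  | succ r ih =>
    have hrows (f : Matrix (Fin (r + 1)) ι K → ℕ) :
        ∑ U, f U = ∑ U : Matrix (Fin r) ι K, ∑ v, f (of (vecCons v U)) :=
      (sum_fin_succ_arrow f).trans sum_comm
    have hsplit : #{U : Matrix (Fin (r + 1)) ι K | IsIsotropicFrame U} =
        ∑ U : Matrix (Fin r) ι K with IsIsotropicFrame U, #{v : ι → K |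
          (v ⬝ᵥ v = 0 ∧ U *ᵥ v = 0) ∧ v ∉ Submodule.span K (Set.range U.row)} := by
      simp only [card_filter, hrows, sum_filter, isIsotropicFrame_vecCons_iff]
      refine sum_congr rfl fun U _ => ?_
      by_cases hU : IsIsotropicFrame U <;> simp [hU]
    rw [hsplit, Nat.cast_sum, sum_congr rfl fun U hU =>
      IsIsotropicFrame.card_extension hK hι ((mem_filter_univ U).1 hU), sum_const, nsmul_eq_mul, ih,
      Fin.prod_univ_castSucc]
    rfl

end IsotropicFrame

section Count

open Classical in
theorem card_linearIndependent_eq_prod {K V : Type*} [Field K] [Fintype K] [AddCommGroup V]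
    [Module K V] [Fintype V] (r : ℕ) :
    (#{a : Fin r → V | LinearIndependent K a} : ℤ) =
      ∏ i : Fin r, ((Fintype.card V : ℤ) - Fintype.card K ^ (i : ℕ)) := by
  rw [← Fintype.card_subtype, ← Nat.card_eq_fintype_card,
    Module.card_eq_pow_finrank (K := K) (V := V)]
  rcases le_or_gt r (Module.finrank K V) with hr | hr
  · rw [card_linearIndependent hr, Nat.cast_prod]
    refine prod_congr rfl fun i _ => ?_
    push_cast [Nat.pow_le_pow_right (Fintype.card_pos (α := K)) (i.isLt.le.trans hr)]
    rfl
  · have hempty : IsEmpty {a : Fin r → V // LinearIndependent K a} :=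
      ⟨fun a => hr.not_ge (by simpa using a.2.fintype_card_le_finrank)⟩
    rw [Nat.card_of_isEmpty, prod_eq_zero (mem_univ ⟨Module.finrank K V, hr⟩)]
    · rfl
    · simp

open Classical in
theorem card_linearIndependent_span_eq {K V : Type*} [Field K] [Fintype K] [AddCommGroup V]
    [Module K V] [Fintype V] {r : ℕ} {W : Submodule K V} (hW : Module.finrank K W = r) :
    (#{a : Fin r → V | LinearIndependent K a ∧ W = Submodule.span K (Set.range a)} : ℤ) =
      ∏ i : Fin r, ((Fintype.card K : ℤ) ^ r - Fintype.card K ^ (i : ℕ)) := by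
  have hcard := card_linearIndependent_eq_prod (K := K) (V := W) r
  rw [Module.card_eq_pow_finrank (K := K) (V := W), hW, Nat.cast_pow] at hcard
  rw [← hcard, Nat.cast_inj]
  refine (card_bij (fun b _ => W.subtype ∘ b) (fun b hb => ?_) (fun b _ b' _ h => ?_)
    fun a ha => ?_).symm
  · rw [mem_filter_univ] at hb ⊢
    have hspan := hb.span_eq_top_of_card_eq_finrank' (by rw [hW, Fintype.card_fin])
    refine ⟨hb.map' W.subtype W.ker_subtype, ?_⟩
    rw [Set.range_comp, Submodule.span_image, hspan, Submodule.map_top, Submodule.range_subtype]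
  · exact W.injective_subtype.comp_left h
  · rw [mem_filter_univ] at ha
    have hmem (k) : a k ∈ W := ha.2 ▸ Submodule.subset_span (Set.mem_range_self k)
    exact ⟨fun k => ⟨a k, hmem k⟩, (mem_filter_univ _).2 (ha.1.of_comp W.subtype), rfl⟩

variable {K F ι : Type*} [Field K] [Fintype K] [Field F] [Fintype F] [Algebra K F] [Fintype ι]
  {s r : ℕ}

open Classical in
theorem card_isFrobeniusIsotropic_span_eq (hrs : r ≤ s) {a : Fin r → F}
    (ha : LinearIndependent K a) :
    #{x : ι → F | IsFrobeniusIsotropic K s x ∧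
        Submodule.span K (Set.range x) = Submodule.span K (Set.range a)} =
      #{U : Matrix (Fin r) ι K | IsIsotropicFrame U} := by
  rw [← card_image_of_injective _ (rowCombination_injective ha)]
  congr 1
  ext x
  rw [mem_filter_univ, mem_image]
  simp only [mem_filter_univ]
  refine ⟨fun ⟨hx, hspan⟩ => ?_, ?_⟩
  · obtain ⟨U, rfl⟩ := exists_rowCombination_eq (hspan ▸ Submodule.subset_span)
    exact ⟨U, ⟨(span_range_rowCombination_eq_iff ha).1 hspan,
      (isFrobeniusIsotropic_rowCombination_iff hrs ha).1 hx⟩, rfl⟩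
  · rintro ⟨U, ⟨hU, hUU⟩, rfl⟩
    exact ⟨(isFrobeniusIsotropic_rowCombination_iff hrs ha).2 hUU,
      (span_range_rowCombination_eq_iff ha).2 hU⟩

open Classical in
/-- Double counting of the pairs formed by a solution `x` and a basis `a` of the span of its
entries. -/
theorem card_isFrobeniusIsotropic_finrank_eq_mul (hrs : r ≤ s) :
    (#{x : ι → F | IsFrobeniusIsotropic K s x ∧
        Module.finrank K (Submodule.span K (Set.range x)) = r} : ℤ) *
        ∏ i : Fin r, ((Fintype.card K : ℤ) ^ r - Fintype.card K ^ (i : ℕ)) =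
      (∏ i : Fin r, ((Fintype.card F : ℤ) - Fintype.card K ^ (i : ℕ))) *
        #{U : Matrix (Fin r) ι K | IsIsotropicFrame U} := by
  set S : Finset (ι → F) := {x | IsFrobeniusIsotropic K s x ∧
    Module.finrank K (Submodule.span K (Set.range x)) = r} with hS
  set T : Finset (Fin r → F) := {a | LinearIndependent K a} with hT
  let SameSpan (x : ι → F) (a : Fin r → F) : Prop :=
    Submodule.span K (Set.range x) = Submodule.span K (Set.range a)
  have habove {x} (hx : x ∈ S) : (#(T.bipartiteAbove SameSpan x) : ℤ) =
      ∏ i : Fin r, ((Fintype.card K : ℤ) ^ r - Fintype.card K ^ (i : ℕ)) := by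
    rw [bipartiteAbove, hT, filter_filter]
    exact card_linearIndependent_span_eq ((mem_filter_univ x).1 hx).2
  have hbelow {a} (ha : a ∈ T) :
      #(S.bipartiteBelow SameSpan a) = #{U : Matrix (Fin r) ι K | IsIsotropicFrame U} := by
    rw [mem_filter_univ] at ha
    rw [← card_isFrobeniusIsotropic_span_eq hrs ha, bipartiteBelow, hS, filter_filter]
    congr 1
    refine filter_congr fun x _ => and_assoc.trans (and_congr_right fun _ => ?_)
    refine and_iff_right_of_imp fun hxa => ?_
    rw [hxa, finrank_span_eq_card ha, Fintype.card_fin]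
  rw [← card_linearIndependent_eq_prod (K := K), ← nsmul_eq_mul, ← nsmul_eq_mul, ← sum_const,
    ← sum_const, ← sum_congr rfl fun x hx => habove hx,
    ← sum_congr rfl fun a ha => congrArg Nat.cast (hbelow ha)]
  exact_mod_cast sum_card_bipartiteAbove_eq_sum_card_bipartiteBelow SameSpan

open Classical in
theorem card_isFrobeniusIsotropic_eq_sum (hs : Fintype.card ι < 2 * s) :
    #{x : ι → F | IsFrobeniusIsotropic K s x} =
      ∑ r ∈ range s, #{x : ι → F | IsFrobeniusIsotropic K s x ∧
        Module.finrank K (Submodule.span K (Set.range x)) = r} := by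
  simp only [← filter_filter]
  refine card_eq_sum_card_fiberwise fun x hx => ?_
  rw [mem_coe, mem_filter_univ] at hx
  exact mem_coe.2 (mem_range.2 (hx.finrank_span_range_lt hs))

end Count

section FiveVariables

variable {K F ι : Type*} [Field K] [Fintype K] [Field F] [Fintype F] [Algebra K F] [Fintype ι]

theorem ncard_isFrobeniusIsotropic_three (hK : ringChar K ≠ 2) (hι : Fintype.card ι = 5) :
    ({x : ι → F | IsFrobeniusIsotropic K 3 x}.ncard : ℤ) =
      ((Fintype.card K : ℤ) + 1) * (Fintype.card K ^ 2 + 1) * (Fintype.card F - 1) *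
        (Fintype.card F - Fintype.card K + 1) + 1 := by
  classical
  have hcount (r : ℕ) (hr : r ≤ 3) :=
    card_isFrobeniusIsotropic_finrank_eq_mul (K := K) (F := F) (ι := ι) hr
  simp only [card_isIsotropicFrame hK (hι ▸ ⟨2, rfl⟩ : Odd (Fintype.card ι))] at hcount
  rw [← coe_filter_univ, Set.ncard_coe_finset,
    card_isFrobeniusIsotropic_eq_sum (by lia : Fintype.card ι < 2 * 3)]
  have hzero := hcount 0 (by lia)
  have hone := hcount 1 (by lia)
  have htwo := hcount 2 (by lia)
  simp only [Fin.prod_univ_zero, mul_one] at hzero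
  simp only [Fin.prod_univ_one, Fin.val_zero, pow_zero, pow_one, hι, Nat.reduceSub] at hone
  simp only [Fin.prod_univ_two, Fin.val_zero, Fin.val_one, pow_zero, pow_one, hι,
    Nat.reduceSub] at htwo
  simp only [sum_range_succ, sum_range_zero, zero_add, Nat.cast_add, hzero]
  have hq : 0 < (Fintype.card K : ℤ) - 1 := sub_pos.2 (mod_cast Fintype.one_lt_card)
  set q := (Fintype.card K : ℤ)
  set Q := (Fintype.card F : ℤ)
  have hbases : (q ^ 2 - 1) * (q ^ 2 - q) ≠ 0 := by
    rw [show (q ^ 2 - 1) * (q ^ 2 - q) = (q - 1) ^ 2 * (q + 1) * q by ring]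
    have : 0 < q := by lia
    positivity
  replace hone := mul_right_cancel₀ hq.ne'
    (hone.trans (by ring : _ = (Q - 1) * (q + 1) * (q ^ 2 + 1) * (q - 1)))
  replace htwo := mul_right_cancel₀ hbases
    (htwo.trans (by ring : _ = (Q - 1) * (Q - q) * (q + 1) * (q ^ 2 + 1) * (_ * _)))
  rw [hone, htwo]
  ring

end FiveVariables

theorem solutionSet_eq (p : ℕ) [Fact p.Prime] (F : Type*) [Field F] :
    solutionSet p F = {x | IsFrobeniusIsotropic (ZMod p) 3 x} := by
  ext x
  simp only [solutionSet, IsFrobeniusIsotropic, dotProduct, ← pow_succ', ZMod.card,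
    Set.mem_ofPred_eq]
  refine ⟨fun h j hj => ?_, fun h => ⟨h 0 (by lia), ?_, h 2 (by lia)⟩⟩
  · interval_cases j
    exacts [h.1, by simpa only [pow_one] using h.2.1, h.2.2]
  · simpa only [pow_one] using h 1 (by lia)

section TraceCharacter

variable (p : ℕ) [Fact p.Prime] (F : Type*) [Field F] [Algebra (ZMod p) F]

/-- The additive character `x ↦ ζ_p ^ Tr x` of `F`. -/
noncomputable def traceChar : AddChar F ℂ :=
  ZMod.stdAddChar.compAddMonoidHom (Algebra.trace (ZMod p) F).toAddMonoidHom

variable {F}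

theorem traceChar_apply (x : F) : traceChar p F x =
    Complex.exp (2 * Real.pi * Complex.I / p) ^ (Algebra.trace (ZMod p) F x).val := by
  have h := ZMod.stdAddChar_coe (N := p) (Algebra.trace (ZMod p) F x).val
  rw [Int.cast_natCast, ZMod.natCast_zmod_val] at h
  rw [← Complex.exp_nat_mul]
  refine h.trans (congrArg Complex.exp ?_)
  push_cast
  ring

theorem isPrimitive_traceChar [Finite F] : (traceChar p F).IsPrimitive := by
  refine AddChar.IsPrimitive.of_ne_one fun h => ?_
  obtain ⟨x, hx⟩ := Algebra.trace_surjective (ZMod p) F 1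
  have hstd : ZMod.stdAddChar (1 : ZMod p) = 1 := hx ▸ DFunLike.congr_fun h x
  rw [← AddChar.map_zero_eq_one (ZMod.stdAddChar (N := p))] at hstd
  exact one_ne_zero (ZMod.injective_stdAddChar hstd)

variable [Fintype F]

theorem expSum_pow (α β γ : F) (n : ℕ) : expSum p α β γ ^ n =
    ∑ x : Fin n → F, traceChar p F (![α, β, γ] ⬝ᵥ
      ![∑ i, x i ^ 2, ∑ i, x i ^ (p + 1), ∑ i, x i ^ (p ^ 2 + 1)]) := by
  simp only [expSum, ← traceChar_apply]
  rw [Fintype.sum_pow]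
  refine sum_congr rfl fun x _ => ?_
  rw [← addChar_sum_eq_prod]
  simp [mul_sum, sum_add_distrib, add_assoc]

theorem sum_expSum_pow_five :
    ∑ α : F, ∑ β : F, ∑ γ : F, expSum p α β γ ^ 5 = (M5 p F : ℂ) * (Fintype.card F : ℂ) ^ 3 := by
  classical
  let g (x : Fin 5 → F) : Fin 3 → F := ![∑ i, x i ^ 2, ∑ i, x i ^ (p + 1), ∑ i, x i ^ (p ^ 2 + 1)]
  have hsol : #{x | g x = 0} = M5 p F := by
    rw [M5, ← Set.ncard_coe_finset, coe_filter_univ]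
    exact congrArg _ (Set.ext fun x => by simp [g, solutionSet])
  have htriple (f : (Fin 3 → F) → ℂ) : ∑ a, f a = ∑ α, ∑ β, ∑ γ, f ![α, β, γ] := by
    simp only [sum_fin_succ_arrow, Fintype.sum_unique]
    rfl
  simp only [expSum_pow]
  rw [← htriple fun a => ∑ x, traceChar p F (a ⬝ᵥ g x),
    sum_sum_addChar_dotProduct (isPrimitive_traceChar p), hsol, Fintype.card_fin]

end TraceCharacter

theorem lemma13_general {p : ℕ} [Fact p.Prime] (hp : p ≠ 2) (m : ℕ) (F : Type*) [Field F]
    [Fintype F] [Algebra (ZMod p) F] (hF : Fintype.card F = p ^ m) :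
    (M5 p F : ℤ) = ((p : ℤ) + 1) * (p ^ 2 + 1) * (p ^ m - 1) * (p ^ m - p + 1) + 1 ∧
      ∑ α : F, ∑ β : F, ∑ γ : F, expSum p α β γ ^ 5 = (M5 p F : ℂ) * (p : ℂ) ^ (3 * m) := by
  have hring : ringChar (ZMod p) ≠ 2 := by rwa [ZMod.ringChar_zmod_n]
  have hcount := ncard_isFrobeniusIsotropic_three (F := F) hring (Fintype.card_fin 5)
  rw [← solutionSet_eq, ← M5, ZMod.card, hF, Nat.cast_pow] at hcount
  refine ⟨hcount, ?_⟩
  rw [sum_expSum_pow_five, hF, Nat.cast_pow, ← pow_mul, mul_comm m]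

theorem lemma13 (p m : ℕ) (hp : p = 3) (F : Type*) [Field F] [Fintype F] [Algebra (ZMod p) F]
    (hF : Fintype.card F = p ^ m) :
    (M5 p F : ℤ) = 5 * ((p : ℤ) ^ m - 1) * (8 * (p : ℤ) ^ m - 2 * (p : ℤ) - 10) + 1 ∧
      ∑ α : F, ∑ β : F, ∑ γ : F, expSum p α β γ ^ 5 = (M5 p F : ℂ) * (p : ℂ) ^ (3 * m) := by
  subst hp
  obtain ⟨hM5, hsum⟩ := lemma13_general (by norm_num) m F hF
  exact ⟨by rw [hM5]; push_cast; ring, hsum⟩
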